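/- Fix an integer $d\ge 1$. Let $X^{(1)},X^{(2)},\dots$ be i.i.d. random vectors in $\mathbb R^d$, each with independent Exponential$(1)$ coordinates. Write $x\prec y$ if $x_j<y_j$ for all $j\in\{1,\dots,d\}$, and $x\le y$ if $x_j\le y_j$ for all $j$. For $n\ge 0$ let $$\mathrm{RS}_n=\{x\in[0,\infty)^d:\ x\not\prec X^{(i)}\text{ for all }1\le i\le n\}$$ be the record-setting region after $n$ observations, and let $F_n$ be the topological boundary of $\mathrm{RS}_n$ relative to $[0,\infty)^d$. The generators at time $n$ are the minimal points of $F_n$ with respect to $\le$; let $\gamma_{d,n}$ denote their number. Then, for every $n$, $\gamma_{d,n}$ is almost surely finite and has finite expectation, and, as $n\to\infty$ with $d$ fixed, $$\mathbb E\,\gamma_{d,n}=(\ln n)^{d-1}\sum_{j=0}^{d-1}a_{d,j}(\ln n)^{-j}+O\!\left(n^{-1}(\ln n)^{d-1}\right),$$ where, for $0\le j\le d-1$, $$a_{d,j}=\sum_{k=0}^{j}\binom{d}{d-j+k}\frac{(-1)^k\,\Gamma^{(k)}(d-j+k)}{k!\,(d-1-j)!},$$ with $\Gamma^{(k)}$ the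 $k$th derivative of the Gamma function. In particular, $a_{d,0}=1$. -/

import Mathlib

open MeasureTheory ProbabilityTheory Filter Asymptotics

open scoped Nat

/-- The closed positive orthant `[0, ∞)^d` determined by the origin. -/
def closedOrthant (d : ℕ) : Set (Fin d → ℝ) := {x | ∀ j, 0 ≤ x j}

/-- `x ≺ y`: strict inequality in every coordinate. -/
def Prec {d : ℕ} (x y : Fin d → ℝ) : Prop := ∀ j, x j < y j

/-- The record-setting region after the first `n` observations `x 0, …, x (n - 1)`:
the points `y ≥ 0` such that `y ⊀ x i` for each of these observations. -/
def recordSettingRegion {d : ℕ} (x : ℕ → Fin d → ℝ) (n : ℕ) : Set (Fin d → ℝ) :=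
  {y | y ∈ closedOrthant d ∧ ∀ i < n, ¬ Prec y (x i)}

/-- The frontier after `n` observations: the topological boundary of the record-setting region
relative to the closed positive orthant (that is, in the subspace topology of the orthant). -/
def recordFrontier {d : ℕ} (x : ℕ → Fin d → ℝ) (n : ℕ) : Set (Fin d → ℝ) :=
  Subtype.val '' frontier
    ((Subtype.val : closedOrthant d → Fin d → ℝ) ⁻¹' recordSettingRegion x n)

/-- The generators after `n` observations: the minimal points of the frontier for the
coordinatewise order `≤`. -/
def generators {d : ℕ} (x : ℕ → Fin d → ℝ) (n : ℕ) : Set (Fin d → ℝ) :=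
  {g | Minimal (fun y => y ∈ recordFrontier x n) g}

/-- The number of generators after `n` observations. -/
noncomputable def numGenerators {d : ℕ} (x : ℕ → Fin d → ℝ) (n : ℕ) : ℕ :=
  (generators x n).ncard

/-- The coefficient
`a_{d,j} = ∑_{k=0}^{j} C(d, d-j+k) (-1)^k Γ^{(k)}(d-j+k) / (k! (d-1-j)!)`, for `0 ≤ j ≤ d - 1`. -/
noncomputable def genCoeff (d j : ℕ) : ℝ :=
  ∑ k ∈ Finset.range (j + 1),
    (d.choose (d - j + k) : ℝ) *
      (((-1 : ℝ) ^ k * iteratedDeriv k Real.Gamma ((d - j + k : ℕ) : ℝ)) /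
        ((k ! : ℝ) * ((d - 1 - j)! : ℝ)))

/-! A generator whose positive coordinates form a set S of size m+1 is pinned down by m+1 distinct
observations, one for each j in S. The j-th attains coordinate j of the generator and exceeds it in
the other coordinates of S, and no remaining observation dominates it on S (`Generates`). Almost
surely all coordinates are positive and there are no ties, so counting generators means counting
such pairs (S, i) (`numGenerators_eq_sum`).

Given the touching coordinates z, with sum s, the pair generates with probability
e^{-ms}(1-e^{-s})^{n-m-1} (`measure_generates_given`). This depends only on s, which has an Erlang
law. There are C(d,m+1) sets S, and n(n-1)...(n-m) injections for each. With u = n e^{-s}, the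
expectation becomes an exact sum over m of integrals on (0,n) of (ln n - ln u)^m u^m (1-u/n)^{n-m-1}
(`integral_numGenerators`).

The binomial factor, normalized by the falling factorial over n^{m+1}, differs from e^{-u} by
O((1+u+u^2)e^{-u}/n). This gives an error O(n^{-1}(ln n)^m) in each integral
(`isBigO_descFactorial_mul_integral_sub`). Expanding (ln n - ln u)^m against u^m e^{-u} produces the
derivatives of Gamma at m+1, and collecting powers of ln n gives the coefficients
(`pow_mul_sum_genCoeff`). -/

/-! ### Deterministic geometry of the frontier and its generators. -/

/-- The points of the frontier are the points of the record-setting region that lie weakly below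
some observation. -/
theorem mem_recordFrontier_iff {d n : ℕ} {x : ℕ → Fin d → ℝ} (hpos : ∀ i < n, ∀ j, 0 < x i j)
    (y : Fin d → ℝ) :
    y ∈ recordFrontier x n ↔ y ∈ recordSettingRegion x n ∧ ∃ i < n, ∀ j, y j ≤ x i j := by
  set R : Set (closedOrthant d) := Subtype.val ⁻¹' recordSettingRegion x n with hR
  have hmem : ∀ z : closedOrthant d, z ∈ R ↔ ∀ i < n, ¬ Prec z.1 (x i) := fun z =>
    ⟨fun h => h.2, fun h => ⟨z.2, h⟩⟩
  have hcomp : Rᶜ = ⋃ i ∈ Set.Iio n, {z : closedOrthant d | Prec z.1 (x i)} := by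
    ext z
    simp [hmem]
  have hopen : ∀ i, IsOpen {z : closedOrthant d | Prec z.1 (x i)} := by
    intro i
    have : {z : closedOrthant d | Prec z.1 (x i)} = ⋂ j, {z | z.1 j < x i j} := by
      ext z; simp [Prec]
    rw [this]
    exact isOpen_iInter_of_finite fun j => isOpen_lt
      ((continuous_apply j).comp continuous_subtype_val) continuous_const
  have hclosed : IsClosed R := by
    rw [← isOpen_compl_iff, hcomp]
    exact isOpen_biUnion fun i _ => hopen i
  have hclos : closure Rᶜ = {z : closedOrthant d | ∃ i < n, ∀ j, z.1 j ≤ x i j} := by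
    apply Set.Subset.antisymm
    · have hcl : IsClosed {z : closedOrthant d | ∃ i < n, ∀ j, z.1 j ≤ x i j} := by
        have : {z : closedOrthant d | ∃ i < n, ∀ j, z.1 j ≤ x i j} =
            ⋃ i ∈ Set.Iio n, ⋂ j, {z : closedOrthant d | z.1 j ≤ x i j} := by
          ext z; simp
        rw [this]
        exact (Set.finite_Iio n).isClosed_biUnion fun i _ =>
          isClosed_iInter fun j => isClosed_le
            ((continuous_apply j).comp continuous_subtype_val) continuous_const
      refine closure_minimal ?_ hcl
      intro z hz
      rw [hcomp] at hz
      simp only [Set.mem_iUnion, Set.mem_Iio, Set.mem_ofPred_eq, exists_prop] at hz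
      obtain ⟨i, hi, h⟩ := hz
      exact ⟨i, hi, fun j => (h j).le⟩
    · rintro z ⟨i, hi, hz⟩
      -- Shrinking z towards the origin makes it strictly smaller than an observation with positive
      -- coordinates. The clamp `max 0 t` keeps the curve in the orthant for every real t.
      have hmaps : ∀ t : ℝ, max 0 t • z.1 ∈ closedOrthant d := fun t j =>
        mul_nonneg (le_max_left _ _) (z.2 j)
      have htend : Tendsto (fun t : ℝ => (⟨max 0 t • z.1, hmaps t⟩ : closedOrthant d))
          (nhdsWithin 1 (Set.Iio 1)) (nhds z) := by
        have hc : Continuous (fun t : ℝ => (⟨max 0 t • z.1, hmaps t⟩ : closedOrthant d)) := by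
          fun_prop
        have := (hc.tendsto 1).mono_left (nhdsWithin_le_nhds (s := Set.Iio 1))
        convert this using 2
        ext; simp
      refine mem_closure_of_tendsto htend ?_
      filter_upwards [Ioo_mem_nhdsLT (zero_lt_one' ℝ)] with t ht
      rw [Set.mem_compl_iff, hmem]
      push Not
      refine ⟨i, hi, fun j => ?_⟩
      have h0 := z.2 j
      have hp := hpos i hi j
      have hzj := hz j
      simp only [max_eq_right ht.1.le, Pi.smul_apply, smul_eq_mul]
      rcases h0.eq_or_lt with h | h
      · simpa [← h] using hp
      · nlinarith [ht.2]
  rw [recordFrontier, ← hR, frontier_eq_closure_inter_closure, hclosed.closure_eq, hclos]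
  constructor
  · rintro ⟨z, ⟨hz, hi⟩, rfl⟩
    exact ⟨hz, hi⟩
  · rintro ⟨hy, hi⟩
    exact ⟨⟨y, hy.1⟩, ⟨hy, hi⟩, rfl⟩

/-- The observations `x (i j)`, `j ∈ S`, determine a generator: each of them attains the coordinate
`j` of the generator and exceeds the generator in the other coordinates of `S`, and no other
observation dominates the generator on `S`. -/
def Generates {d n : ℕ} (x : ℕ → Fin d → ℝ) (S : Finset (Fin d)) (i : S ↪ Fin n) : Prop :=
  (∀ j k : S, k ≠ j → x (i k) k < x (i j) k) ∧
    ∀ r : Fin n, r ∉ Set.range i → ∃ k : S, x r k ≤ x (i k) k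

/-- The point with coordinates `x (i j) j` on `S` and `0` elsewhere. -/
noncomputable def genPoint {d n : ℕ} (x : ℕ → Fin d → ℝ) (S : Finset (Fin d)) (i : S ↪ Fin n) :
    Fin d → ℝ :=
  fun j => if h : j ∈ S then x (i ⟨j, h⟩) j else 0

theorem genPoint_coe {d n : ℕ} (x : ℕ → Fin d → ℝ) (S : Finset (Fin d)) (i : S ↪ Fin n) (j : S) :
    genPoint x S i j = x (i j) j := by
  simp [genPoint]

theorem genPoint_of_notMem {d n : ℕ} (x : ℕ → Fin d → ℝ) {S : Finset (Fin d)} (i : S ↪ Fin n)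
    {j : Fin d} (hj : j ∉ S) : genPoint x S i j = 0 := by
  simp [genPoint, hj]

theorem genPoint_nonneg {d n : ℕ} {x : ℕ → Fin d → ℝ} (hpos : ∀ i < n, ∀ j, 0 < x i j)
    (S : Finset (Fin d)) (i : S ↪ Fin n) (j : Fin d) : 0 ≤ genPoint x S i j := by
  unfold genPoint
  split_ifs
  · exact (hpos _ (Fin.is_lt _) _).le
  · exact le_rfl

theorem Generates.nonempty {d n : ℕ} {x : ℕ → Fin d → ℝ} {S : Finset (Fin d)} {i : S ↪ Fin n}
    (hn : 0 < n) (h : Generates x S i) : S.Nonempty := by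
  by_contra hS
  obtain ⟨k, _⟩ := h.2 ⟨0, hn⟩ (by rintro ⟨j, _⟩; exact hS ⟨j, j.2⟩)
  exact hS ⟨k, k.2⟩

theorem Generates.genPoint_le {d n : ℕ} {x : ℕ → Fin d → ℝ} (hpos : ∀ i < n, ∀ j, 0 < x i j)
    {S : Finset (Fin d)} {i : S ↪ Fin n} (h : Generates x S i) (j : S) (k : Fin d) :
    genPoint x S i k ≤ x (i j) k := by
  by_cases hk : k ∈ S
  · have := genPoint_coe x S i ⟨k, hk⟩
    rw [this]
    by_cases hkj : (⟨k, hk⟩ : S) = j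
    · subst hkj; exact le_rfl
    · exact (h.1 j ⟨k, hk⟩ hkj).le
  · rw [genPoint_of_notMem x i hk]
    exact (hpos _ (Fin.is_lt _) _).le

/-- Minimality: a frontier point below the generator and strictly smaller in coordinate j of S would
be strictly dominated by the observation `i j`. -/
theorem Generates.mem_generators {d n : ℕ} {x : ℕ → Fin d → ℝ} (hn : 0 < n)
    (hpos : ∀ i < n, ∀ j, 0 < x i j) {S : Finset (Fin d)} {i : S ↪ Fin n}
    (h : Generates x S i) : genPoint x S i ∈ generators x n := by
  have hF : genPoint x S i ∈ recordFrontier x n := by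
    rw [mem_recordFrontier_iff hpos]
    refine ⟨⟨genPoint_nonneg hpos S i, fun r hr hprec => ?_⟩, ?_⟩
    · by_cases hri : (⟨r, hr⟩ : Fin n) ∈ Set.range i
      · obtain ⟨j, hj⟩ := hri
        have := hprec j
        rw [genPoint_coe, hj] at this
        exact lt_irrefl _ this
      · obtain ⟨k, hk⟩ := h.2 _ hri
        have := hprec k
        rw [genPoint_coe] at this
        exact absurd this hk.not_gt
    · obtain ⟨j, hj⟩ := h.nonempty hn
      exact ⟨i ⟨j, hj⟩, Fin.is_lt _, h.genPoint_le hpos ⟨j, hj⟩⟩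
  refine ⟨hF, fun z hz hzg j => ?_⟩
  by_contra! hlt
  replace hz := (mem_recordFrontier_iff hpos z).1 hz
  have hjS : j ∈ S := by
    by_contra hj
    rw [genPoint_of_notMem x i hj] at hlt
    exact absurd (hz.1.1 j) hlt.not_ge
  refine hz.1.2 (i ⟨j, hjS⟩) (Fin.is_lt _) fun k => ?_
  by_cases hk : k ∈ S
  · by_cases hkj : (⟨k, hk⟩ : S) = ⟨j, hjS⟩
    · obtain rfl : k = j := congrArg Subtype.val hkj
      have := genPoint_coe x S i ⟨k, hk⟩
      rw [← this]; exact hlt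
    · have h1 := h.1 ⟨j, hjS⟩ ⟨k, hk⟩ hkj
      have h2 := hzg k
      have := genPoint_coe x S i ⟨k, hk⟩
      rw [this] at h2
      exact h2.trans_lt h1
  · have h2 := hzg k
    rw [genPoint_of_notMem x i hk] at h2
    exact h2.trans_lt (hpos _ (Fin.is_lt _) _)

/-- Lowering one positive coordinate j of a minimal point slightly must leave the record-setting
region, so some observation strictly dominates the lowered point. As it does not dominate the
original point, it must agree with it in coordinate j. -/
theorem exists_generates_of_mem_generators {d n : ℕ} {x : ℕ → Fin d → ℝ}
    (hpos : ∀ i < n, ∀ j, 0 < x i j) {y : Fin d → ℝ} (hy : y ∈ generators x n) :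
    ∃ (S : Finset (Fin d)) (i : S ↪ Fin n), Generates x S i ∧ genPoint x S i = y := by
  classical
  obtain ⟨hyF, hmin⟩ := hy
  rw [mem_recordFrontier_iff hpos] at hyF
  obtain ⟨⟨hy0, hyR⟩, i₀, hi₀, hyi₀⟩ := hyF
  set S : Finset (Fin d) := Finset.univ.filter fun j => 0 < y j with hS
  have key : ∀ j : S, ∃ i : Fin n, x i j = y j ∧ ∀ k : Fin d, k ≠ j → y k < x i k := by
    rintro ⟨j, hj⟩
    have hj0 : 0 < y j := by simpa [hS] using hj
    -- No observation has its j-th coordinate strictly between δ and y j, so an observation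
    -- exceeding δ there is at least y j.
    obtain ⟨δ, hδ0, hδy, hδ⟩ : ∃ δ, 0 ≤ δ ∧ δ < y j ∧ ∀ i < n, x i j < y j → x i j ≤ δ := by
      set T : Finset ℝ := insert 0 (((Finset.range n).image fun i => x i j).filter (· < y j))
      have hT : T.Nonempty := ⟨0, by simp [T]⟩
      refine ⟨T.max' hT, T.le_max' 0 (by simp [T]), ?_, fun i hi hlt => T.le_max' _ ?_⟩
      · have := T.max'_mem hT
        simp only [T, Finset.mem_insert, Finset.mem_filter] at this
        rcases this with h | h
        · exact h ▸ hj0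
        · exact h.2
      · simp only [T, Finset.mem_insert, Finset.mem_filter, Finset.mem_image, Finset.mem_range]
        exact Or.inr ⟨⟨i, hi, rfl⟩, hlt⟩
    set z : Fin d → ℝ := Function.update y j δ with hz
    have hzy : z ≤ y := by
      rw [hz, update_le_iff]
      exact ⟨hδy.le, fun _ _ => le_rfl⟩
    have hz0 : z ∈ closedOrthant d := by
      intro k
      by_cases hk : k = j
      · subst hk; simpa [hz] using hδ0
      · simpa [hz, hk] using hy0 k
    have hzR : z ∉ recordSettingRegion x n := by
      intro hzR
      have hzF : z ∈ recordFrontier x n := by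
        rw [mem_recordFrontier_iff hpos]
        exact ⟨hzR, i₀, hi₀, fun k => (hzy k).trans (hyi₀ k)⟩
      have := hmin hzF hzy j
      simp only [hz, Function.update_self] at this
      exact absurd hδy this.not_gt
    obtain ⟨i, hi, hprec⟩ : ∃ i < n, Prec z (x i) := by
      by_contra! hcon
      exact hzR ⟨hz0, hcon⟩
    have hne : ∀ k, k ≠ j → y k < x i k := by
      intro k hk
      have := hprec k
      simpa [hz, hk] using this
    have hjx : y j ≤ x i j := by
      by_contra! hlt
      have h1 := hδ i hi hlt
      have h2 := hprec j
      simp only [hz, Function.update_self] at h2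
      exact absurd h2 h1.not_gt
    refine ⟨⟨i, hi⟩, ?_, hne⟩
    by_contra hxy
    refine hyR i hi fun k => ?_
    by_cases hk : k = j
    · subst hk
      exact lt_of_le_of_ne hjx (Ne.symm hxy)
    · exact hne k hk
  choose i hi1 hi2 using key
  have hinj : Function.Injective i := by
    intro j k hjk
    by_contra hne
    have := hi2 j k (fun h => hne (Subtype.ext h.symm))
    rw [hjk, hi1 k] at this
    exact lt_irrefl _ this
  have hgen : genPoint x S ⟨i, hinj⟩ = y := by
    ext j
    by_cases hj : j ∈ S
    · have := genPoint_coe x S ⟨i, hinj⟩ ⟨j, hj⟩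
      rw [this]
      exact hi1 ⟨j, hj⟩
    · rw [genPoint_of_notMem x _ hj]
      have : ¬ 0 < y j := by simpa [hS] using hj
      exact le_antisymm (hy0 j) (not_lt.1 this)
  refine ⟨S, ⟨i, hinj⟩, ⟨fun j k hkj => ?_, fun r hr => ?_⟩, hgen⟩
  · change x (i k) k < x (i j) k
    rw [hi1 k]
    exact hi2 j k fun h => hkj (Subtype.ext h)
  · by_contra! hcon
    refine hyR r r.2 fun k => ?_
    by_cases hk : k ∈ S
    · have := hcon ⟨k, hk⟩
      change x (i ⟨k, hk⟩) k < x r k at this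
      rwa [hi1 ⟨k, hk⟩] at this
    · have : ¬ 0 < y k := by simpa [hS] using hk
      exact (not_lt.1 this).trans_lt (hpos r r.2 k)

/-- In general position the generators correspond bijectively to the generating pairs. -/
theorem generators_eq_image {d n : ℕ} {x : ℕ → Fin d → ℝ} (hn : 0 < n)
    (hpos : ∀ i < n, ∀ j, 0 < x i j) :
    generators x n = (fun p : Σ S : Finset (Fin d), (S ↪ Fin n) => genPoint x p.1 p.2) ''
      {p | Generates x p.1 p.2} := by
  ext y
  constructor
  · intro hy
    obtain ⟨S, i, h, rfl⟩ := exists_generates_of_mem_generators hpos hy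
    exact ⟨⟨S, i⟩, h, rfl⟩
  · rintro ⟨⟨S, i⟩, h, rfl⟩
    exact Generates.mem_generators hn hpos h

/-- S is recovered as the set of nonzero coordinates, and the absence of ties then recovers each
observation from its coordinate value. -/
theorem genPoint_injective {d n : ℕ} {x : ℕ → Fin d → ℝ}
    (hpos : ∀ i < n, ∀ j, 0 < x i j)
    (hties : ∀ i < n, ∀ i' < n, ∀ j, x i j = x i' j → i = i') :
    Function.Injective
      (fun p : Σ S : Finset (Fin d), (S ↪ Fin n) => genPoint x p.1 p.2) := by
  have hsub : ∀ (S T : Finset (Fin d)) (i : S ↪ Fin n) (i' : T ↪ Fin n),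
      genPoint x S i = genPoint x T i' → S ⊆ T := by
    intro S T i i' h j hj
    by_contra hjT
    have h1 := congrFun h j
    have := genPoint_coe x S i ⟨j, hj⟩
    rw [genPoint_of_notMem x i' hjT, this] at h1
    exact absurd h1 (hpos _ (Fin.is_lt _) _).ne'
  rintro ⟨S, i⟩ ⟨T, i'⟩ h
  obtain rfl : S = T := (hsub _ _ _ _ h).antisymm (hsub _ _ _ _ h.symm)
  congr 1
  ext j
  have h1 := congrFun h j
  simp only [genPoint_coe] at h1
  exact hties _ (Fin.is_lt _) _ (Fin.is_lt _) _ h1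

theorem finite_generators {d n : ℕ} {x : ℕ → Fin d → ℝ} (hn : 0 < n)
    (hpos : ∀ i < n, ∀ j, 0 < x i j) : (generators x n).Finite := by
  rw [generators_eq_image hn hpos]
  exact (Set.toFinite _).image _

open Classical in
theorem numGenerators_eq_sum {d n : ℕ} {x : ℕ → Fin d → ℝ} (hn : 0 < n)
    (hpos : ∀ i < n, ∀ j, 0 < x i j)
    (hties : ∀ i < n, ∀ i' < n, ∀ j, x i j = x i' j → i = i') :
    (numGenerators x n : ℝ) =
      ∑ S : Finset (Fin d), ∑ i : S ↪ Fin n, if Generates x S i then (1 : ℝ) else 0 := by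
  rw [numGenerators, generators_eq_image hn hpos,
    Set.ncard_image_of_injective _ (genPoint_injective hpos hties), Set.ncard_eq_toFinset_card',
    Finset.sum_sigma', Finset.sum_boole]
  congr 2
  ext p
  simp

/-- With no observations the region is the whole orthant, whose boundary relative to itself is
empty. -/
theorem generators_zero {d : ℕ} (x : ℕ → Fin d → ℝ) : generators x 0 = ∅ := by
  ext y
  simp only [generators, Set.mem_ofPred_eq, Set.mem_empty_iff_false, iff_false]
  intro h
  have := (mem_recordFrontier_iff (n := 0) (by simp) y).1 h.1
  simp at this

/-! ### The exponential law and its sums. -/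

theorem expMeasure_one_eq : expMeasure 1 =
    (volume.restrict (Set.Ioi (0 : ℝ))).withDensity fun x => ENNReal.ofReal (Real.exp (-x)) := by
  rw [← withDensity_indicator measurableSet_Ioi]
  change volume.withDensity (gammaPDF 1 1) = _
  refine withDensity_congr_ae ?_
  -- The exponential density is 1 at the origin while the indicator of (0, ∞) vanishes there, so the
  -- two agree only almost everywhere.
  have h0 : ∀ᵐ x : ℝ, x ≠ 0 := by simp [ae_iff, measure_singleton]
  filter_upwards [h0] with x hx
  change exponentialPDF 1 x = _
  rw [exponentialPDF_eq]
  rcases lt_or_gt_of_ne hx with h | h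
  · simp [h.not_ge, h.not_gt]
  · simp [h.le, h]

instance isProbabilityMeasure_expMeasure_one : IsProbabilityMeasure (expMeasure 1) :=
  isProbabilityMeasure_expMeasure zero_lt_one

instance nullSingletonClass_expMeasure_one : NullSingletonClass (expMeasure 1) :=
  ⟨fun x => by
    rw [expMeasure_one_eq]
    exact withDensity_absolutelyContinuous _ _ (measure_singleton x)⟩

theorem lintegral_expMeasure_one {f : ℝ → ENNReal} (hf : Measurable f) :
    ∫⁻ x, f x ∂expMeasure 1 =
      ∫⁻ x in Set.Ioi 0, ENNReal.ofReal (Real.exp (-x)) * f x := by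
  rw [expMeasure_one_eq, lintegral_withDensity_eq_lintegral_mul _ (by fun_prop) hf]
  rfl

theorem integral_expMeasure_one (f : ℝ → ℝ) :
    ∫ x, f x ∂expMeasure 1 = ∫ x in Set.Ioi 0, Real.exp (-x) * f x := by
  rw [expMeasure_one_eq, integral_withDensity_eq_integral_toReal_smul (by fun_prop) (by simp)]
  simp [ENNReal.toReal_ofReal (Real.exp_pos _).le]

theorem integrable_expMeasure_one_iff (f : ℝ → ℝ) :
    Integrable f (expMeasure 1) ↔ IntegrableOn (fun x => Real.exp (-x) * f x) (Set.Ioi 0) := by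
  rw [expMeasure_one_eq, integrable_withDensity_iff_integrable_smul' (by fun_prop) (by simp)]
  simp [ENNReal.toReal_ofReal (Real.exp_pos _).le, IntegrableOn]

theorem expMeasure_one_Ioi {x : ℝ} (hx : 0 ≤ x) :
    expMeasure 1 (Set.Ioi x) = ENNReal.ofReal (Real.exp (-x)) := by
  have h := prob_compl_eq_one_sub (μ := expMeasure 1) (measurableSet_Iic (a := x))
  rw [Set.compl_Iic] at h
  rw [h, ← ofReal_cdf, cdf_expMeasure_eq zero_lt_one, if_pos hx, ← ENNReal.ofReal_one,
    ← ENNReal.ofReal_sub _ (by simpa using hx)]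
  simp

theorem ae_expMeasure_one_pos : ∀ᵐ x ∂expMeasure 1, 0 < x := by
  rw [expMeasure_one_eq]
  exact (withDensity_absolutelyContinuous _ _).ae_le (ae_restrict_mem measurableSet_Ioi)

/-- The density of the sum of `m + 1` independent standard exponential variables. -/
noncomputable def erlangDensity (m : ℕ) : ℝ → ENNReal :=
  (Set.Ioi (0 : ℝ)).indicator fun s => ENNReal.ofReal (s ^ m / m ! * Real.exp (-s))

theorem measurable_erlangDensity (m : ℕ) : Measurable (erlangDensity m) :=
  Measurable.indicator (by fun_prop) measurableSet_Ioi

theorem lintegral_expMeasure_one_eq_erlangDensity {f : ℝ → ENNReal} (hf : Measurable f) :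
    ∫⁻ x, f x ∂expMeasure 1 = ∫⁻ x, erlangDensity 0 x * f x := by
  rw [lintegral_expMeasure_one hf, ← lintegral_indicator measurableSet_Ioi]
  congr with x
  by_cases hx : x ∈ Set.Ioi (0 : ℝ) <;> simp [erlangDensity, hx]

theorem lintegral_erlangDensity_mul_sub (m : ℕ) (t : ℝ) :
    ∫⁻ x, erlangDensity 0 x * erlangDensity m (t - x) = erlangDensity (m + 1) t := by
  have h1 : ∀ x, erlangDensity 0 x * erlangDensity m (t - x) =
      (Set.Ioo 0 t).indicator
        (fun x => ENNReal.ofReal ((t - x) ^ m / m ! * Real.exp (-t))) x := by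
    intro x
    by_cases hx0 : 0 < x
    · by_cases hxt : x < t
      · rw [Set.indicator_of_mem (show x ∈ Set.Ioo 0 t from ⟨hx0, hxt⟩)]
        simp only [erlangDensity]
        rw [Set.indicator_of_mem (show x ∈ Set.Ioi (0 : ℝ) from hx0),
          Set.indicator_of_mem (show t - x ∈ Set.Ioi (0 : ℝ) from sub_pos.2 hxt),
          ← ENNReal.ofReal_mul (by positivity)]
        congr 1
        rw [show -t = -x + -(t - x) by ring, Real.exp_add]
        simp
        ring
      · simp [erlangDensity, hxt]
    · simp [erlangDensity, hx0]
  simp_rw [h1]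
  rw [lintegral_indicator measurableSet_Ioo]
  rcases le_or_gt t 0 with ht | ht
  · simp [erlangDensity, ht]
  · rw [erlangDensity, Set.indicator_of_mem (show t ∈ Set.Ioi (0 : ℝ) from ht),
      ← ofReal_integral_eq_lintegral_ofReal]
    · congr 1
      rw [← integral_Ioc_eq_integral_Ioo, ← intervalIntegral.integral_of_le ht.le,
        intervalIntegral.integral_mul_const, intervalIntegral.integral_div,
        intervalIntegral.integral_comp_sub_left (fun x => x ^ m), integral_pow]
      simp only [sub_self, sub_zero, Nat.factorial_succ]
      push_cast
      field_simp
      simp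
    · exact (Continuous.integrableOn_Icc (by fun_prop)).mono_set Set.Ioo_subset_Icc_self
    · filter_upwards [ae_restrict_mem measurableSet_Ioo] with x hx
      have := sub_nonneg.2 hx.2.le
      positivity

/-- Induction by splitting off one variable: translation and Tonelli reduce the step to convolving
`erlangDensity 0` with `erlangDensity m`. -/
theorem lintegral_pi_fin_expMeasure_one_sum (m : ℕ) {f : ℝ → ENNReal} (hf : Measurable f) :
    ∫⁻ y, f (∑ j, y j) ∂Measure.pi (fun _ : Fin (m + 1) => expMeasure 1) =
      ∫⁻ s, erlangDensity m s * f s := by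
  induction m generalizing f with
  | zero =>
    have h := (measurePreserving_piUnique (fun _ : Fin 1 => expMeasure 1)).lintegral_comp hf
    rw [← lintegral_expMeasure_one_eq_erlangDensity hf, ← h]
    simp
  | succ m ih =>
    have h := (measurePreserving_piFinSuccAbove
      (fun _ : Fin (m + 2) => expMeasure 1) 0).symm.lintegral_comp
      (f := fun y => f (∑ j, y j)) (hf.comp (by fun_prop))
    rw [← h, lintegral_prod _ (by
      refine (hf.comp ?_).aemeasurable
      have : Measurable fun y : Fin (m + 2) → ℝ => ∑ j, y j := by fun_prop
      exact this.comp (MeasurableEquiv.measurable _))]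
    have h2 : ∀ x : ℝ, ∫⁻ y : Fin (m + 1) → ℝ,
        f (∑ j, (MeasurableEquiv.piFinSuccAbove (fun _ => ℝ) 0).symm (x, y) j)
          ∂Measure.pi (fun _ => expMeasure 1) = ∫⁻ t, erlangDensity m (t - x) * f t := by
      intro x
      have h3 := ih (f := fun s => f (x + s)) (hf.comp (by fun_prop))
      rw [← lintegral_sub_right_eq_self (fun s => erlangDensity m s * f (x + s)) x] at h3
      simp only [add_sub_cancel] at h3
      rw [← h3]
      congr with y
      rw [Fin.sum_univ_succ]
      simp [MeasurableEquiv.piFinSuccAbove]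
    have hmeas : Measurable fun p : ℝ × ℝ =>
        erlangDensity 0 p.1 * (erlangDensity m (p.2 - p.1) * f p.2) :=
      ((measurable_erlangDensity 0).comp measurable_fst).mul
        (((measurable_erlangDensity m).comp (measurable_snd.sub measurable_fst)).mul
          (hf.comp measurable_snd))
    calc _ = ∫⁻ x, ∫⁻ t, erlangDensity m (t - x) * f t ∂volume ∂expMeasure 1 :=
          lintegral_congr h2
      _ = ∫⁻ x, ∫⁻ t, erlangDensity 0 x * (erlangDensity m (t - x) * f t) := by
          rw [lintegral_expMeasure_one_eq_erlangDensity]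
          · refine lintegral_congr fun x => ?_
            rw [lintegral_const_mul]
            exact ((measurable_erlangDensity m).comp (measurable_id.sub_const x)).mul hf
          · refine Measurable.lintegral_prod_right' (f := fun p : ℝ × ℝ =>
              erlangDensity m (p.2 - p.1) * f p.2) ?_
            exact ((measurable_erlangDensity m).comp (measurable_snd.sub measurable_fst)).mul
              (hf.comp measurable_snd)
      _ = ∫⁻ t, ∫⁻ x, erlangDensity 0 x * (erlangDensity m (t - x) * f t) :=
          lintegral_lintegral_swap hmeas.aemeasurable
      _ = _ := by
          refine lintegral_congr fun t => ?_
          simp_rw [← mul_assoc]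
          rw [lintegral_mul_const, lintegral_erlangDensity_mul_sub]
          exact (measurable_erlangDensity 0).mul
            ((measurable_erlangDensity m).comp (measurable_id.const_sub t))

/-- The sum of `m + 1` independent standard exponential variables has an Erlang distribution. -/
theorem lintegral_pi_expMeasure_one_sum {ι : Type*} [Fintype ι] {m : ℕ}
    (hm : Fintype.card ι = m + 1) {f : ℝ → ENNReal} (hf : Measurable f) :
    ∫⁻ y, f (∑ j, y j) ∂Measure.pi (fun _ : ι => expMeasure 1) =
      ∫⁻ s, erlangDensity m s * f s := by
  rw [← lintegral_pi_fin_expMeasure_one_sum m hf]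
  let e : Fin (m + 1) ≃ ι := (Fintype.equivFinOfCardEq hm).symm
  have h := (measurePreserving_piCongrLeft (fun _ : ι => expMeasure 1) e).lintegral_comp
    (f := fun y => f (∑ j, y j)) (hf.comp (by fun_prop))
  rw [← h]
  congr with y
  congr 1
  rw [← Equiv.sum_comp e]
  refine Finset.sum_congr rfl fun j _ => ?_
  exact Equiv.piCongrLeft_apply_apply (fun _ => ℝ) e y j

/-! ### Derivatives of Gamma as logarithmic moments. -/

/-- For U standard exponential, log U has moment generating function Γ(t+1) on t > -1.
Differentiation under the Gamma integral, and integrability of the logarithmic moments, then follow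
from the theory of moment generating functions. -/
theorem Ioi_subset_integrableExpSet_log :
    Set.Ioi (-1) ⊆ integrableExpSet Real.log (expMeasure 1) := by
  intro t ht
  have ht' : 0 < t + 1 := by linarith [Set.mem_Ioi.1 ht]
  change Integrable _ _
  rw [integrable_expMeasure_one_iff]
  refine (Real.GammaIntegral_convergent ht').congr_fun (fun x hx => ?_) measurableSet_Ioi
  simp only [add_sub_cancel_right]
  rw [Real.rpow_def_of_pos hx, mul_comm t]

theorem mem_interior_integrableExpSet_log {t : ℝ} (ht : -1 < t) :
    t ∈ interior (integrableExpSet Real.log (expMeasure 1)) :=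
  interior_maximal Ioi_subset_integrableExpSet_log isOpen_Ioi ht

theorem mgf_log_expMeasure_one {t : ℝ} (ht : -1 < t) :
    mgf Real.log (expMeasure 1) t = Real.Gamma (t + 1) := by
  rw [mgf, integral_expMeasure_one, Real.Gamma_eq_integral (by linarith)]
  refine setIntegral_congr_fun measurableSet_Ioi fun x hx => ?_
  simp only [add_sub_cancel_right]
  rw [Real.rpow_def_of_pos hx, mul_comm t]

theorem iteratedDeriv_Gamma_eq_integral (k m : ℕ) :
    iteratedDeriv k Real.Gamma ((m + 1 : ℕ) : ℝ) =
      ∫ u in Set.Ioi 0, Real.exp (-u) * (Real.log u ^ k * u ^ m) := by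
  have hm : (-1 : ℝ) < m := by have := m.cast_nonneg (α := ℝ); linarith
  have h1 : mgf Real.log (expMeasure 1) =ᶠ[nhds (m : ℝ)] fun t => Real.Gamma (t + 1) := by
    filter_upwards [Ioi_mem_nhds hm] with t ht using mgf_log_expMeasure_one ht
  have h2 := (h1.iteratedDeriv_eq k)
  rw [iteratedDeriv_comp_add_const, iteratedDeriv_mgf (mem_interior_integrableExpSet_log hm),
    integral_expMeasure_one] at h2
  push_cast
  refine h2.symm.trans ?_
  refine setIntegral_congr_fun measurableSet_Ioi fun x hx => ?_
  simp only [mul_comm (m : ℝ), Real.exp_mul, Real.exp_log hx, Real.rpow_natCast]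

theorem integrableOn_exp_neg_mul_log_pow_mul_pow (k m : ℕ) :
    IntegrableOn (fun u => Real.exp (-u) * (Real.log u ^ k * u ^ m)) (Set.Ioi 0) := by
  have hm : (-1 : ℝ) < m := by have := m.cast_nonneg (α := ℝ); linarith
  have h := integrable_pow_mul_exp_of_mem_interior_integrableExpSet
    (mem_interior_integrableExpSet_log hm) k
  rw [integrable_expMeasure_one_iff] at h
  refine h.congr_fun (fun x hx => ?_) measurableSet_Ioi
  simp only [mul_comm (m : ℝ), Real.exp_mul, Real.exp_log hx, Real.rpow_natCast]

theorem integrableOn_exp_neg_mul_abs_log_pow_mul_pow (k m : ℕ) :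
    IntegrableOn (fun u => Real.exp (-u) * (|Real.log u| ^ k * u ^ m)) (Set.Ioi 0) := by
  have hm : (-1 : ℝ) < m := by have := m.cast_nonneg (α := ℝ); linarith
  have h := integrable_pow_abs_mul_exp_of_mem_interior_integrableExpSet
    (mem_interior_integrableExpSet_log hm) k
  rw [integrable_expMeasure_one_iff] at h
  refine h.congr_fun (fun x hx => ?_) measurableSet_Ioi
  simp only [mul_comm (m : ℝ), Real.exp_mul, Real.exp_log hx, Real.rpow_natCast]

/-! ### Poisson approximation with explicit error. -/

theorem one_sub_sq_div_le_descFactorial_div_pow {M n : ℕ} (hM : M ≤ n) (hn : 0 < n) :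
    1 - (M : ℝ) ^ 2 / n ≤ n.descFactorial M / (n : ℝ) ^ M := by
  have hn' : (0 : ℝ) < n := by exact_mod_cast hn
  have hMn : (M : ℝ) ≤ n := by exact_mod_cast hM
  have h1 : ((n + 1 - M : ℕ) : ℝ) ^ M ≤ n.descFactorial M := by
    exact_mod_cast Nat.pow_sub_le_descFactorial n M
  have h2 : 1 + (M : ℝ) * (-((M : ℝ) / n)) ≤ (1 + -((M : ℝ) / n)) ^ M := by
    refine one_add_mul_le_pow ?_ M
    have : (M : ℝ) / n ≤ 1 := (div_le_one hn').2 hMn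
    linarith
  have h3 : (1 + -((M : ℝ) / n)) ^ M ≤ (((n + 1 - M : ℕ) : ℝ) / n) ^ M := by
    refine pow_le_pow_left₀ ?_ ?_ M
    · have : (M : ℝ) / n ≤ 1 := (div_le_one hn').2 hMn
      linarith
    · rw [Nat.cast_sub (by omega), ← sub_eq_add_neg, one_sub_div hn'.ne']
      gcongr
      linarith
  calc 1 - (M : ℝ) ^ 2 / n = 1 + (M : ℝ) * (-((M : ℝ) / n)) := by ring
    _ ≤ _ := h2
    _ ≤ _ := h3
    _ = ((n + 1 - M : ℕ) : ℝ) ^ M / (n : ℝ) ^ M := div_pow _ _ _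
    _ ≤ _ := by gcongr

/-- From (1+t)e^{-t} ≤ 1 one gets e^{-t}(1-t^2) ≤ 1-t; take n-th powers and apply Bernoulli's
inequality to (1-t^2)^n. -/
theorem exp_neg_mul_sub_one_sub_pow_le {t : ℝ} (ht0 : 0 ≤ t) (ht1 : t ≤ 1) (n : ℕ) :
    Real.exp (-(n * t)) - (1 - t) ^ n ≤ n * t ^ 2 * Real.exp (-(n * t)) := by
  have h1 : Real.exp (-t) * (1 - t ^ 2) ≤ 1 - t := by
    have h : (1 + t) * Real.exp (-t) ≤ 1 := by
      have := Real.add_one_le_exp t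
      calc (1 + t) * Real.exp (-t) ≤ Real.exp t * Real.exp (-t) := by
            gcongr; linarith
        _ = 1 := by rw [← Real.exp_add]; simp
    nlinarith
  have hsq : t ^ 2 ≤ 1 := by nlinarith
  have h2 : 1 + (n : ℝ) * (-t ^ 2) ≤ (1 + -t ^ 2) ^ n := one_add_mul_le_pow (by linarith) n
  have h3 : (Real.exp (-t) * (1 - t ^ 2)) ^ n ≤ (1 - t) ^ n :=
    pow_le_pow_left₀ (mul_nonneg (Real.exp_pos _).le (by linarith)) h1 n
  rw [mul_pow, ← Real.exp_nat_mul] at h3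
  have he := Real.exp_pos (n * -t)
  rw [show -((n : ℝ) * t) = n * -t by ring]
  rw [← sub_eq_add_neg] at h2
  nlinarith [mul_le_mul_of_nonneg_left h2 he.le]

/-- Quantitative Poisson approximation of a binomial factor. -/
theorem abs_descFactorial_mul_one_sub_pow_sub_exp_le {M n : ℕ} (hM : M ≤ n) (hn : 0 < n) {t : ℝ}
    (ht0 : 0 ≤ t) (ht1 : t ≤ 1) :
    |n.descFactorial M / (n : ℝ) ^ M * (1 - t) ^ (n - M) - Real.exp (-(n * t))| ≤
      Real.exp M * ((M : ℝ) ^ 2 / n + M * t + n * t ^ 2) * Real.exp (-(n * t)) := by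
  have hn' : (0 : ℝ) < n := by exact_mod_cast hn
  set ρ : ℝ := n.descFactorial M / (n : ℝ) ^ M with hρ
  have hρ1 : ρ ≤ 1 := by
    rw [hρ, div_le_one (by positivity)]
    exact_mod_cast Nat.descFactorial_le_pow n M
  have hρ2 := one_sub_sq_div_le_descFactorial_div_pow hM hn
  rw [← hρ] at hρ2
  set a : ℝ := (1 - t) ^ (n - M) with ha
  set E : ℝ := Real.exp (-(n * t)) with hE
  have hE0 : 0 < E := Real.exp_pos _
  have h1t : 0 ≤ 1 - t := sub_nonneg.2 ht1
  have hexp : 1 - t ≤ Real.exp (-t) := by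
    have := Real.add_one_le_exp (-t); linarith
  have ha0 : 0 ≤ a := pow_nonneg h1t _
  have haE : a ≤ Real.exp M * E := by
    -- The missing M factors cost at most e^{Mt} ≤ e^M, the source of the constant `Real.exp M`.
    calc a ≤ Real.exp (-t) ^ (n - M) := pow_le_pow_left₀ h1t hexp _
      _ = Real.exp (M * t - n * t) := by
        rw [← Real.exp_nat_mul, Nat.cast_sub hM]; ring_nf
      _ ≤ Real.exp (M + -(n * t)) := by
        rw [Real.exp_le_exp]
        have : (M : ℝ) * t ≤ M := mul_le_of_le_one_right (by positivity) ht1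
        linarith
      _ = _ := Real.exp_add _ _
  have hpow : a * (1 - t) ^ M = (1 - t) ^ n := by
    rw [ha, ← pow_add, Nat.sub_add_cancel hM]
  have hbern : 1 - (M : ℝ) * t ≤ (1 - t) ^ M := by
    have := one_add_mul_le_pow (a := -t) (by linarith) M
    rw [← sub_eq_add_neg] at this
    linarith
  have hpow1 : (1 - t) ^ M ≤ 1 := pow_le_one₀ h1t (by linarith)
  have hupper : (1 - t) ^ n ≤ E := by
    calc (1 - t) ^ n ≤ Real.exp (-t) ^ n := pow_le_pow_left₀ h1t hexp _
      _ = E := by rw [← Real.exp_nat_mul, hE]; ring_nf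
  have hlower := exp_neg_mul_sub_one_sub_pow_le ht0 ht1 n
  rw [← hE] at hlower
  have hM1 : 1 ≤ Real.exp M := Real.one_le_exp (by positivity)
  -- Three replacements, one error each: ρ by 1, the exponent n-M by n, and (1-t)^n by e^{-nt}.
  have e1 : |(ρ - 1) * a| ≤ (M : ℝ) ^ 2 / n * (Real.exp M * E) := by
    rw [abs_mul, abs_of_nonneg ha0, abs_of_nonpos (by linarith)]
    exact mul_le_mul (by linarith) haE ha0 (by positivity)
  have e2 : |a - (1 - t) ^ n| ≤ (M : ℝ) * t * (Real.exp M * E) := by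
    rw [← hpow, show a - a * (1 - t) ^ M = (1 - (1 - t) ^ M) * a by ring, abs_mul,
      abs_of_nonneg ha0, abs_of_nonneg (by linarith)]
    exact mul_le_mul (by linarith) haE ha0 (by positivity)
  have e3 : |(1 - t) ^ n - E| ≤ n * t ^ 2 * (Real.exp M * E) := by
    rw [abs_of_nonpos (by linarith)]
    have : E ≤ Real.exp M * E := le_mul_of_one_le_left hE0.le hM1
    have : n * t ^ 2 * E ≤ n * t ^ 2 * (Real.exp M * E) := by gcongr
    linarith
  calc |ρ * a - E| = |(ρ - 1) * a + (a - (1 - t) ^ n) + ((1 - t) ^ n - E)| := by ring_nf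
    _ ≤ _ := abs_add_three _ _ _
    _ ≤ _ := add_le_add (add_le_add e1 e2) e3
    _ = _ := by ring

theorem abs_indicator_descFactorial_sub_exp_le {M n : ℕ} (hM1 : 1 ≤ M) (hM : M ≤ n) {u : ℝ}
    (hu : 0 < u) :
    |(Set.Iio (n : ℝ)).indicator
        (fun u => n.descFactorial M / (n : ℝ) ^ M * (1 - u / n) ^ (n - M)) u - Real.exp (-u)| ≤
      (n : ℝ)⁻¹ * (Real.exp M * M ^ 2) * ((1 + u + u ^ 2) * Real.exp (-u)) := by
  have hn' : (0 : ℝ) < n := by exact_mod_cast hM1.trans hM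
  have hM1' : (1 : ℝ) ≤ M := by exact_mod_cast hM1
  have hE := Real.exp_pos (-u)
  have hMe : 1 ≤ Real.exp M := Real.one_le_exp (by positivity)
  by_cases hun : u < n
  · rw [Set.indicator_of_mem (show u ∈ Set.Iio (n : ℝ) from hun)]
    have h := abs_descFactorial_mul_one_sub_pow_sub_exp_le hM (by omega)
      (div_nonneg hu.le hn'.le) ((div_le_one hn').2 hun.le)
    rw [mul_div_cancel₀ _ hn'.ne'] at h
    refine h.trans ?_
    have : (M : ℝ) ^ 2 / n + M * (u / n) + n * (u / n) ^ 2 ≤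
        (n : ℝ)⁻¹ * (M ^ 2 * (1 + u + u ^ 2)) := by
      have : (M : ℝ) ^ 2 / n + M * (u / n) + n * (u / n) ^ 2 =
        (n : ℝ)⁻¹ * (M ^ 2 + M * u + u ^ 2) := by field_simp
      rw [this]
      gcongr
      nlinarith [mul_nonneg (sub_nonneg.2 hM1') hu.le, mul_nonneg (sub_nonneg.2 hM1') (sq_nonneg u),
        mul_nonneg (mul_nonneg (sub_nonneg.2 hM1') hu.le) (sub_nonneg.2 hM1'),
        mul_nonneg (mul_nonneg (sub_nonneg.2 hM1') (sq_nonneg u)) (sub_nonneg.2 hM1')]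
    calc _ ≤ Real.exp M * ((n : ℝ)⁻¹ * (M ^ 2 * (1 + u + u ^ 2))) * Real.exp (-u) := by gcongr
      _ = _ := by ring
  · rw [Set.indicator_of_notMem (show u ∉ Set.Iio (n : ℝ) from hun), zero_sub, abs_neg,
      abs_of_pos hE]
    -- Beyond the cutoff the whole of e^{-u} is error, absorbed because u/n ≥ 1.
    have h1 : 1 ≤ (n : ℝ)⁻¹ * u := by
      rw [inv_mul_eq_div, one_le_div hn']; exact not_lt.1 hun
    have h2 : 1 ≤ Real.exp M * M ^ 2 := one_le_mul_of_one_le_of_one_le hMe (one_le_pow₀ hM1')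
    calc Real.exp (-u) = 1 * 1 * Real.exp (-u) := by ring
      _ ≤ ((n : ℝ)⁻¹ * u) * (Real.exp M * M ^ 2) * Real.exp (-u) := by gcongr
      _ = (n : ℝ)⁻¹ * (Real.exp M * M ^ 2) * (u * Real.exp (-u)) := by ring
      _ ≤ _ := by
        gcongr
        nlinarith

/-! ### Asymptotic expansion of the integrals. -/

/-- Separates the growth in L from a factor in u alone, so that one integrable function dominates
for all n. -/
theorem abs_sub_log_pow_le {L : ℝ} (hL : 1 ≤ L) (u : ℝ) (m : ℕ) :
    |(L - Real.log u) ^ m| ≤ L ^ m * (2 ^ m * (1 + |Real.log u| ^ m)) := by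
  rw [abs_pow]
  have h1 : |L - Real.log u| ≤ L * (1 + |Real.log u|) := by
    have := abs_sub L (Real.log u)
    rw [abs_of_pos (by linarith : 0 < L)] at this
    nlinarith [mul_nonneg (sub_nonneg.2 hL) (abs_nonneg (Real.log u))]
  have h2 : (1 + |Real.log u|) ^ m ≤ 2 ^ m * (1 + |Real.log u| ^ m) := by
    have := add_pow_le (zero_le_one' ℝ) (abs_nonneg (Real.log u)) m
    rw [one_pow] at this
    refine this.trans ?_
    gcongr
    · norm_num
    · omega
  calc _ ≤ (L * (1 + |Real.log u|)) ^ m := pow_le_pow_left₀ (abs_nonneg _) h1 m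
    _ = L ^ m * (1 + |Real.log u|) ^ m := mul_pow _ _ _
    _ ≤ _ := by gcongr

theorem integrableOn_exp_neg_mul_sub_log_pow_mul_pow (L : ℝ) (m : ℕ) :
    IntegrableOn (fun u => Real.exp (-u) * ((L - Real.log u) ^ m * u ^ m)) (Set.Ioi 0) := by
  have h : (fun u => Real.exp (-u) * ((L - Real.log u) ^ m * u ^ m)) = fun u =>
      ∑ k ∈ Finset.range (m + 1), ((m.choose k : ℝ) * L ^ (m - k) * (-1) ^ k) *
        (Real.exp (-u) * (Real.log u ^ k * u ^ m)) := by
    ext u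
    rw [show L - Real.log u = -Real.log u + L by ring, add_pow, Finset.sum_mul, Finset.mul_sum]
    refine Finset.sum_congr rfl fun k _ => ?_
    rw [neg_pow (Real.log u)]
    ring
  rw [h]
  exact integrable_finsetSum _ fun k _ =>
    (integrableOn_exp_neg_mul_log_pow_mul_pow k m).const_mul _

theorem integral_exp_neg_mul_sub_log_pow_mul_pow (L : ℝ) (m : ℕ) :
    ∫ u in Set.Ioi 0, Real.exp (-u) * ((L - Real.log u) ^ m * u ^ m) =
      ∑ k ∈ Finset.range (m + 1), (m.choose k : ℝ) * L ^ (m - k) *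
        ((-1) ^ k * iteratedDeriv k Real.Gamma ((m + 1 : ℕ) : ℝ)) := by
  have h : (fun u => Real.exp (-u) * ((L - Real.log u) ^ m * u ^ m)) = fun u =>
      ∑ k ∈ Finset.range (m + 1), ((m.choose k : ℝ) * L ^ (m - k) * (-1) ^ k) *
        (Real.exp (-u) * (Real.log u ^ k * u ^ m)) := by
    ext u
    rw [show L - Real.log u = -Real.log u + L by ring, add_pow, Finset.sum_mul, Finset.mul_sum]
    refine Finset.sum_congr rfl fun k _ => ?_
    rw [neg_pow (Real.log u)]
    ring
  rw [h, integral_finsetSum _ fun k _ =>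
    (integrableOn_exp_neg_mul_log_pow_mul_pow k m).const_mul _]
  refine Finset.sum_congr rfl fun k _ => ?_
  rw [integral_const_mul, iteratedDeriv_Gamma_eq_integral]
  ring

/-- The expansion of the integral that gives the expected number of generators with `m + 1`
positive coordinates. -/
theorem isBigO_descFactorial_mul_integral_sub (m : ℕ) :
    (fun n : ℕ => n.descFactorial (m + 1) / (n : ℝ) ^ (m + 1) *
        (∫ u in Set.Ioo 0 (n : ℝ), (Real.log n - Real.log u) ^ m * u ^ m *
          (1 - u / n) ^ (n - (m + 1))) -
      ∑ k ∈ Finset.range (m + 1), (m.choose k : ℝ) * Real.log n ^ (m - k) *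
        ((-1) ^ k * iteratedDeriv k Real.Gamma ((m + 1 : ℕ) : ℝ)))
      =O[atTop] fun n : ℕ => (n : ℝ)⁻¹ * Real.log n ^ m := by
  set C : ℝ := Real.exp ((m + 1 : ℕ) : ℝ) * ((m + 1 : ℕ) : ℝ) ^ 2 with hC
  have hC0 : 0 ≤ C := by positivity
  -- Dominating function independent of n: the bound on the logarithmic power times u^m times the
  -- Poisson error.
  set B : ℝ → ℝ := fun u =>
    (2 ^ m * (1 + |Real.log u| ^ m)) * u ^ m * ((1 + u + u ^ 2) * Real.exp (-u)) with hB
  have hBint : IntegrableOn B (Set.Ioi 0) := by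
    have h := ((((integrableOn_exp_neg_mul_abs_log_pow_mul_pow 0 m).add
      (integrableOn_exp_neg_mul_abs_log_pow_mul_pow 0 (m + 1))).add
      (integrableOn_exp_neg_mul_abs_log_pow_mul_pow 0 (m + 2))).add
      (((integrableOn_exp_neg_mul_abs_log_pow_mul_pow m m).add
      (integrableOn_exp_neg_mul_abs_log_pow_mul_pow m (m + 1))).add
      (integrableOn_exp_neg_mul_abs_log_pow_mul_pow m (m + 2)))).const_mul (2 ^ m)
    refine h.congr (ae_of_all _ fun u => ?_)
    simp only [hB, Pi.add_apply]
    ring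
  refine IsBigO.of_bound (C * ∫ u in Set.Ioi 0, B u) ?_
  filter_upwards [eventually_ge_atTop (m + 1), eventually_ge_atTop 3] with n hn hn3
  have hn' : (0 : ℝ) < n := by exact_mod_cast (by omega : 0 < n)
  have hL : 1 ≤ Real.log n := by
    rw [Real.le_log_iff_exp_le hn']
    exact Real.exp_one_lt_three.le.trans (by exact_mod_cast hn3)
  set L := Real.log n with hLdef
  set ρ : ℝ := n.descFactorial (m + 1) / (n : ℝ) ^ (m + 1) with hρ
  set D : ℝ → ℝ := (Set.Iio (n : ℝ)).indicator
    (fun u => ρ * (1 - u / n) ^ (n - (m + 1))) with hD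
  set w : ℝ → ℝ := fun u => (L - Real.log u) ^ m * u ^ m with hw
  have hwmeas : Measurable w := by fun_prop
  have hDmeas : Measurable D := Measurable.indicator (by fun_prop) measurableSet_Iio
  have hbound : ∀ᵐ u ∂volume.restrict (Set.Ioi (0 : ℝ)),
      ‖w u * D u - Real.exp (-u) * w u‖ ≤ (n : ℝ)⁻¹ * L ^ m * C * B u := by
    filter_upwards [ae_restrict_mem measurableSet_Ioi] with u hu
    have hu0 : 0 < u := hu
    rw [show w u * D u - Real.exp (-u) * w u = w u * (D u - Real.exp (-u)) by ring, norm_mul,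
      Real.norm_eq_abs, Real.norm_eq_abs]
    have h1 := abs_indicator_descFactorial_sub_exp_le (by omega) hn hu0
    have h2 : |w u| ≤ L ^ m * (2 ^ m * (1 + |Real.log u| ^ m)) * u ^ m := by
      simp only [hw]
      rw [abs_mul, abs_of_nonneg (pow_nonneg hu0.le m)]
      gcongr
      exact abs_sub_log_pow_le hL u m
    refine (mul_le_mul h2 h1 (abs_nonneg _) (by positivity)).trans_eq ?_
    simp only [hB, hC]
    ring
  have hdiff : IntegrableOn (fun u => w u * D u - Real.exp (-u) * w u) (Set.Ioi 0) :=
    (hBint.const_mul _).mono' (by fun_prop) hbound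
  have hmain : IntegrableOn (fun u => Real.exp (-u) * w u) (Set.Ioi 0) :=
    integrableOn_exp_neg_mul_sub_log_pow_mul_pow L m
  have hF : IntegrableOn (fun u => w u * D u) (Set.Ioi 0) := by
    refine (hdiff.add hmain).congr (ae_of_all _ fun u => ?_)
    simp
  have hFeq : ρ * (∫ u in Set.Ioo 0 (n : ℝ), (L - Real.log u) ^ m * u ^ m *
      (1 - u / n) ^ (n - (m + 1))) = ∫ u in Set.Ioi 0, w u * D u := by
    rw [← integral_const_mul, ← Set.Ioi_inter_Iio, ← setIntegral_indicator measurableSet_Iio]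
    refine integral_congr_ae (ae_of_all _ fun u => ?_)
    by_cases hu : u ∈ Set.Iio (n : ℝ)
    · simp only [hD, Set.indicator_of_mem hu, hw]
      ring
    · simp [hD, Set.indicator_of_notMem hu]
  rw [hFeq, ← integral_exp_neg_mul_sub_log_pow_mul_pow, ← integral_sub hF hmain]
  refine (norm_integral_le_of_norm_le (hBint.const_mul _) hbound).trans_eq ?_
  rw [integral_const_mul, Real.norm_of_nonneg (by positivity)]
  ring

/-! ### Probability that given observations generate. -/

section

variable {d : ℕ} {Ω : Type*} [MeasurableSpace Ω] {P : Measure Ω} {X : ℕ → Ω → Fin d → ℝ}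

theorem map_coord_eq_expMeasure (hmeas : ∀ i, Measurable (X i))
    (hlaw : ∀ i, P.map (X i) = Measure.pi (fun _ : Fin d => expMeasure 1)) (i : ℕ) (j : Fin d) :
    P.map (fun ω => X i ω j) = expMeasure 1 := by
  have h : (fun ω => X i ω j) = Function.eval j ∘ X i := rfl
  rw [h, ← Measure.map_map (measurable_pi_apply j) (hmeas i), hlaw]
  exact (measurePreserving_eval (fun _ : Fin d => expMeasure 1) j).map_eq

/-- Independence across observations combines with independence within each one, which is what the
product law expresses. -/
theorem iIndepFun_coord [IsProbabilityMeasure P] (hmeas : ∀ i, Measurable (X i))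
    (hlaw : ∀ i, P.map (X i) = Measure.pi (fun _ : Fin d => expMeasure 1))
    (hindep : iIndepFun X P) :
    iIndepFun (fun (p : ℕ × Fin d) ω => X p.1 ω p.2) P := by
  have hm : ∀ i j, Measurable fun ω => X i ω j := fun i j =>
    (measurable_pi_apply j).comp (hmeas i)
  refine iIndepFun_uncurry' (X := fun i j ω => X i ω j) hm hindep fun i => ?_
  rw [iIndepFun_iff_map_fun_eq_pi_map fun j => (hm i j).aemeasurable]
  simp_rw [map_coord_eq_expMeasure hmeas hlaw i]
  exact hlaw i

theorem measure_forall_lt_coord [IsProbabilityMeasure P] (hmeas : ∀ i, Measurable (X i))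
    (hlaw : ∀ i, P.map (X i) = Measure.pi (fun _ : Fin d => expMeasure 1))
    (hindep : iIndepFun X P) (r : ℕ) {S : Finset (Fin d)} {z : S → ℝ} (hz : ∀ k, 0 < z k)
    (U : Finset S) :
    P {ω | ∀ k ∈ U, z k < X r ω k} = ENNReal.ofReal (Real.exp (-∑ k ∈ U, z k)) := by
  have h1 := (iIndepFun_coord hmeas hlaw hindep).precomp (g := fun k : S => (r, (k : Fin d)))
    (fun a b h => Subtype.ext (congrArg Prod.snd h))
  have h2 := h1.measure_inter_preimage_eq_mul U (sets := fun k => Set.Ioi (z k))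
    (fun k _ => measurableSet_Ioi)
  have h3 : {ω | ∀ k ∈ U, z k < X r ω k} =
      ⋂ k ∈ U, (fun ω => X (r, (k : Fin d)).1 ω (r, (k : Fin d)).2) ⁻¹' Set.Ioi (z k) := by
    ext ω; simp
  rw [h3]
  refine h2.trans ?_
  rw [← Finset.sum_neg_distrib, Real.exp_sum,
    ENNReal.ofReal_prod_of_nonneg fun k _ => (Real.exp_pos _).le]
  refine Finset.prod_congr rfl fun k _ => ?_
  have hm : Measurable fun ω => X r ω k := (measurable_pi_apply _).comp (hmeas r)
  rw [← expMeasure_one_Ioi (hz k).le, ← map_coord_eq_expMeasure hmeas hlaw r k,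
    Measure.map_apply hm measurableSet_Ioi]

theorem ae_pos_coord (hmeas : ∀ i, Measurable (X i))
    (hlaw : ∀ i, P.map (X i) = Measure.pi (fun _ : Fin d => expMeasure 1)) :
    ∀ᵐ ω ∂P, ∀ i j, 0 < X i ω j := by
  rw [ae_all_iff]
  intro i
  rw [ae_all_iff]
  intro j
  have h := ae_expMeasure_one_pos
  rw [← map_coord_eq_expMeasure hmeas hlaw i j] at h
  exact ae_of_ae_map ((measurable_pi_apply j).comp (hmeas i)).aemeasurable h

theorem ae_coord_ne [IsProbabilityMeasure P] (hmeas : ∀ i, Measurable (X i))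
    (hlaw : ∀ i, P.map (X i) = Measure.pi (fun _ : Fin d => expMeasure 1))
    (hindep : iIndepFun X P) :
    ∀ᵐ ω ∂P, ∀ i i' : ℕ, ∀ j, X i ω j = X i' ω j → i = i' := by
  rw [ae_all_iff]
  intro i
  rw [ae_all_iff]
  intro i'
  rw [ae_all_iff]
  intro j
  by_cases hii : i = i'
  · exact ae_of_all _ fun _ _ => hii
  have hm : ∀ i, Measurable fun ω => X i ω j := fun i =>
    (measurable_pi_apply j).comp (hmeas i)
  have h1 : IndepFun (fun ω => X i ω j) (fun ω => X i' ω j) P :=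
    (iIndepFun_coord hmeas hlaw hindep).indepFun (i := (i, j)) (j := (i', j))
      (fun h => hii (congrArg Prod.fst h))
  have h2 := h1.map_prod_eq_prod_map_map (hm i).aemeasurable (hm i').aemeasurable
  rw [map_coord_eq_expMeasure hmeas hlaw, map_coord_eq_expMeasure hmeas hlaw] at h2
  have h3 : ∀ᵐ p ∂(expMeasure 1).prod (expMeasure 1), p.1 ≠ p.2 := by
    have hs : MeasurableSet {p : ℝ × ℝ | p.1 = p.2} :=
      measurableSet_eq_fun measurable_fst measurable_snd
    have h4 : (expMeasure 1).prod (expMeasure 1) {p : ℝ × ℝ | p.1 = p.2} = 0 := by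
      rw [Measure.measure_prod_null hs]
      refine ae_of_all _ fun x => ?_
      have : Prod.mk x ⁻¹' {p : ℝ × ℝ | p.1 = p.2} = {x} := by
        ext y; simp [eq_comm]
      change expMeasure 1 (Prod.mk x ⁻¹' {p : ℝ × ℝ | p.1 = p.2}) = 0
      rw [this]
      exact measure_singleton x
    simpa [ae_iff] using h4
  rw [← h2] at h3
  filter_upwards [ae_of_ae_map ((hm i).prodMk (hm i')).aemeasurable h3] with ω hω h
  exact absurd h hω

theorem measurableSet_generates (hmeas : ∀ i, Measurable (X i)) {n : ℕ} (S : Finset (Fin d))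
    (i : S ↪ Fin n) : MeasurableSet {ω | Generates (fun r => X r ω) S i} := by
  have hm : ∀ i j, Measurable fun ω => X i ω j := fun i j =>
    (measurable_pi_apply j).comp (hmeas i)
  have h : {ω | Generates (fun r => X r ω) S i} =
      (⋂ (j : S) (k : S) (_ : k ≠ j), {ω | X (i k) ω k < X (i j) ω k}) ∩
      ⋂ (r : Fin n) (_ : r ∉ Set.range i), ⋃ k : S, {ω | X r ω k ≤ X (i k) ω k} := by
    ext ω
    simp [Generates]
  rw [h]
  refine MeasurableSet.inter ?_ ?_
  · exact .iInter fun j => .iInter fun k => .iInter fun _ => measurableSet_lt (hm _ _) (hm _ _)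
  · exact .iInter fun r => .iInter fun _ => .iUnion fun k => measurableSet_le (hm _ _) (hm _ _)

/-- The probability that the observations `i`, given their coordinates `z` that enter the generator,
generate. -/
theorem measure_generates_given [IsProbabilityMeasure P] (hmeas : ∀ i, Measurable (X i))
    (hlaw : ∀ i, P.map (X i) = Measure.pi (fun _ : Fin d => expMeasure 1))
    (hindep : iIndepFun X P) {n m : ℕ} {S : Finset (Fin d)} (hS : S.card = m + 1)
    (i : S ↪ Fin n) {z : S → ℝ} (hz : ∀ k, 0 < z k) :
    P {ω | (∀ j k : S, k ≠ j → z k < X (i j) ω k) ∧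
        ∀ r : Fin n, r ∉ Set.range i → ∃ k : S, X r ω k ≤ z k} =
      ENNReal.ofReal (Real.exp (-(m * ∑ k, z k)) *
        (1 - Real.exp (-∑ k, z k)) ^ (n - (m + 1))) := by
  classical
  -- With z fixed, the event splits into one constraint per observation, hence into independent
  -- events.
  set B : Fin n → Set (Fin d → ℝ) := fun r =>
    {v | (∀ j, i j = r → ∀ k : S, k ≠ j → z k < v k) ∧ (r ∉ Set.range i → ∃ k : S, v k ≤ z k)}
    with hB
  have hBi : ∀ j : S, B (i j) = {v | ∀ k ∈ Finset.univ.erase j, z k < v k} := by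
    intro j
    ext v
    simp only [hB, Set.mem_ofPred_eq, Set.mem_range_self, not_true_eq_false, false_imp_iff,
      and_true, Finset.mem_erase, Finset.mem_univ]
    constructor
    · intro h k hk
      exact h j rfl k hk
    · rintro h j' hj' k hk
      obtain rfl := i.injective hj'
      exact h k hk
  have hBo : ∀ r, r ∉ Set.range i → B r = {v | ∀ k ∈ (Finset.univ : Finset S), z k < v k}ᶜ := by
    intro r hr
    ext v
    simp only [hB, Set.mem_ofPred_eq, hr, not_false_eq_true, true_imp_iff, Set.mem_compl_iff,
      Finset.mem_univ, not_forall, not_lt]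
    refine ⟨fun h => h.2, fun h => ⟨fun j hj => absurd ⟨j, hj⟩ hr, h⟩⟩
  have hbox : ∀ U : Finset S, MeasurableSet {v : Fin d → ℝ | ∀ k ∈ U, z k < v k} := by
    intro U
    have : {v : Fin d → ℝ | ∀ k ∈ U, z k < v k} = ⋂ k ∈ U, {v | z k < v k} := by ext; simp
    rw [this]
    exact Finset.measurableSet_biInter _ fun k _ =>
      measurableSet_lt measurable_const (measurable_pi_apply _)
  have hBmeas : ∀ r, MeasurableSet (B r) := by
    intro r
    by_cases hr : r ∈ Set.range i
    · obtain ⟨j, rfl⟩ := hr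
      rw [hBi]; exact hbox _
    · rw [hBo r hr]; exact (hbox _).compl
  have hset : {ω | (∀ j k : S, k ≠ j → z k < X (i j) ω k) ∧
      ∀ r : Fin n, r ∉ Set.range i → ∃ k : S, X r ω k ≤ z k} =
      ⋂ r ∈ (Finset.univ : Finset (Fin n)), (fun ω => X r ω) ⁻¹' B r := by
    ext ω
    simp only [hB, Set.mem_ofPred_eq, Finset.mem_univ, Set.iInter_true, Set.mem_iInter,
      Set.mem_preimage]
    constructor
    · rintro ⟨h1, h2⟩ r
      exact ⟨fun j hj k hk => hj ▸ h1 j k hk, h2 r⟩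
    · intro h
      exact ⟨fun j k hk => (h (i j)).1 j rfl k hk, fun r => (h r).2⟩
  have hind := (hindep.precomp (g := fun r : Fin n => (r : ℕ)) Fin.val_injective
    ).measure_inter_preimage_eq_mul Finset.univ (sets := B) (fun r _ => hBmeas r)
  have hin : ∀ j : S, P ((fun ω => X (i j) ω) ⁻¹' B (i j)) =
      ENNReal.ofReal (Real.exp (-(∑ k, z k - z j))) := by
    intro j
    have h := measure_forall_lt_coord hmeas hlaw hindep (i j) hz (Finset.univ.erase j)
    rw [Finset.sum_erase_eq_sub (Finset.mem_univ j)] at h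
    rw [hBi, ← h]
    rfl
  have hout : ∀ r, r ∉ Set.range i → P ((fun ω => X r ω) ⁻¹' B r) =
      ENNReal.ofReal (1 - Real.exp (-∑ k, z k)) := by
    intro r hr
    have h := measure_forall_lt_coord hmeas hlaw hindep r hz Finset.univ
    rw [hBo r hr, Set.preimage_compl, prob_compl_eq_one_sub (hmeas r (hbox _)),
      ENNReal.ofReal_sub _ (Real.exp_pos _).le, ENNReal.ofReal_one, ← h]
    rfl
  have hsum : 0 ≤ ∑ k, z k := Finset.sum_nonneg fun k _ => (hz k).le
  have h1e : 0 ≤ 1 - Real.exp (-∑ k, z k) := by simpa using hsum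
  rw [hset]
  refine hind.trans ?_
  rw [← Finset.prod_mul_prod_compl (Finset.univ.map i), Finset.prod_map,
    ENNReal.ofReal_mul (Real.exp_pos _).le, ENNReal.ofReal_pow h1e]
  congr 1
  · rw [Finset.prod_congr rfl fun j _ => hin j,
      ← ENNReal.ofReal_prod_of_nonneg fun k _ => (Real.exp_pos _).le, ← Real.exp_sum]
    -- Summing s - z j over the m+1 indices gives (m+1)s - s = ms.
    congr 2
    rw [Finset.sum_neg_distrib, Finset.sum_sub_distrib]
    simp [hS]
    ring
  · rw [Finset.prod_congr rfl fun r hr => hout r (by simpa using hr), Finset.prod_const,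
      Finset.card_compl, Finset.card_map]
    simp [hS]

/-- The touching coordinates Z and the other coordinates W involve disjoint index sets, hence are
independent. Integrating the probability for fixed Z = z over the law of Z leaves a function of the
sum of z, to which the Erlang law applies. -/
theorem measure_generates [IsProbabilityMeasure P] (hmeas : ∀ i, Measurable (X i))
    (hlaw : ∀ i, P.map (X i) = Measure.pi (fun _ : Fin d => expMeasure 1))
    (hindep : iIndepFun X P) {n m : ℕ} {S : Finset (Fin d)} (hS : S.card = m + 1)
    (i : S ↪ Fin n) :
    P {ω | Generates (fun r => X r ω) S i} =
      ∫⁻ s, erlangDensity m s * ENNReal.ofReal (Real.exp (-(m * s)) *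
        (1 - Real.exp (-s)) ^ (n - (m + 1))) := by
  classical
  have hcoord := iIndepFun_coord hmeas hlaw hindep
  have hm : ∀ i j, Measurable fun ω => X i ω j := fun i j =>
    (measurable_pi_apply j).comp (hmeas i)
  set D : Finset (ℕ × Fin d) :=
    Finset.univ.image fun j : S => ((i j : ℕ), (j : Fin d)) with hD
  set T : Finset (ℕ × Fin d) := (Finset.range n ×ˢ Finset.univ) \ D with hT
  have hDmem : ∀ j : S, ((i j : ℕ), (j : Fin d)) ∈ D := fun j => by simp [hD]
  have hTmem : ∀ (r : Fin n) (k : S), r ≠ i k → ((r : ℕ), (k : Fin d)) ∈ T := by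
    intro r k hrk
    simp only [hT, hD, Finset.mem_sdiff, Finset.mem_product, Finset.mem_range, Finset.mem_univ,
      and_true, Finset.mem_image, true_and, Prod.mk.injEq, not_exists, not_and, r.is_lt]
    intro j hj hjk
    obtain rfl : j = k := Subtype.ext hjk
    exact hrk (Fin.ext hj.symm)
  set Z : Ω → S → ℝ := fun ω j => X (i j) ω j with hZ
  -- The default 0 off T is never consulted: each clause of `Generates` compares a touching
  -- coordinate with one of a different observation.
  set W : Ω → ℕ × Fin d → ℝ := fun ω p => if p ∈ T then X p.1 ω p.2 else 0 with hW
  have hZmeas : Measurable Z := measurable_pi_lambda _ fun j => hm _ _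
  have hWmeas : Measurable W := by
    refine measurable_pi_lambda _ fun p => ?_
    by_cases hp : p ∈ T
    · simpa [hW, hp] using hm _ _
    · simp [hW, hp]
  have hZW : IndepFun Z W P := by
    have h := hcoord.indepFun_finset D T (by rw [hT]; exact Finset.disjoint_sdiff)
      (fun p => hm p.1 p.2)
    have hf : Measurable fun (a : D → ℝ) (j : S) => a ⟨_, hDmem j⟩ :=
      measurable_pi_lambda _ fun j => measurable_pi_apply _
    have hg : Measurable fun (a : T → ℝ) (p : ℕ × Fin d) =>
        if hp : p ∈ T then a ⟨p, hp⟩ else 0 := by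
      refine measurable_pi_lambda _ fun p => ?_
      by_cases hp : p ∈ T
      · simpa [hp] using measurable_pi_apply _
      · simp [hp]
    refine IndepFun.congr (h.comp hf hg) ?_ ?_
    · exact ae_of_all _ fun ω => rfl
    · refine ae_of_all _ fun ω => ?_
      ext p
      by_cases hp : p ∈ T <;> simp [hW, hp]
  set A : Set ((S → ℝ) × (ℕ × Fin d → ℝ)) :=
    {q | (∀ j k : S, k ≠ j → q.1 k < q.2 (i j, k)) ∧
      ∀ r : Fin n, r ∉ Set.range i → ∃ k : S, q.2 (r, k) ≤ q.1 k} with hA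
  have hAmeas : MeasurableSet A := by
    have h : A = (⋂ (j : S) (k : S) (_ : k ≠ j), {q | q.1 k < q.2 (i j, k)}) ∩
        ⋂ (r : Fin n) (_ : r ∉ Set.range i), ⋃ k : S, {q | q.2 (r, k) ≤ q.1 k} := by
      ext q
      simp [hA]
    rw [h]
    refine MeasurableSet.inter ?_ ?_
    · exact .iInter fun j => .iInter fun k => .iInter fun _ =>
        measurableSet_lt (by fun_prop) (by fun_prop)
    · exact .iInter fun r => .iInter fun _ => .iUnion fun k =>
        measurableSet_le (by fun_prop) (by fun_prop)
  have hAW : ∀ (z : S → ℝ) (ω : Ω), (z, W ω) ∈ A ↔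
      (∀ j k : S, k ≠ j → z k < X (i j) ω k) ∧
        ∀ r : Fin n, r ∉ Set.range i → ∃ k : S, X r ω k ≤ z k := by
    intro z ω
    simp only [hA, Set.mem_ofPred_eq]
    refine and_congr ?_ ?_
    · refine forall_congr' fun j => forall_congr' fun k => imp_congr_right fun hkj => ?_
      have : W ω (i j, k) = X (i j) ω k :=
        if_pos (hTmem (i j) k fun h => hkj (i.injective h).symm)
      rw [this]
    · refine forall_congr' fun r => imp_congr_right fun hr => exists_congr fun k => ?_
      have : W ω (r, k) = X r ω k := if_pos (hTmem r k fun h => hr ⟨k, h.symm⟩)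
      rw [this]
  have hmapZ : P.map Z = Measure.pi fun _ : S => expMeasure 1 := by
    have h1 := hcoord.precomp (g := fun j : S => ((i j : ℕ), (j : Fin d)))
      (fun a b h => Subtype.ext (congrArg Prod.snd h))
    have h2 := iIndepFun.map_fun_eq_pi_map (fun j => (hm (i j) j).aemeasurable) h1
    refine h2.trans ?_
    congr with j : 1
    exact map_coord_eq_expMeasure hmeas hlaw _ _
  have hset : {ω | Generates (fun r => X r ω) S i} = (fun ω => (Z ω, W ω)) ⁻¹' A := by
    ext ω
    exact (hAW (Z ω) ω).symm
  rw [hset, ← Measure.map_apply (hZmeas.prodMk hWmeas) hAmeas,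
    hZW.map_prod_eq_prod_map_map hZmeas.aemeasurable hWmeas.aemeasurable, hmapZ,
    Measure.prod_apply hAmeas,
    ← lintegral_pi_expMeasure_one_sum (ι := S) (by simpa using hS) (by fun_prop)]
  have hpos : ∀ᵐ z ∂Measure.pi fun _ : S => expMeasure 1, ∀ k, 0 < z k := by
    rw [ae_all_iff]
    intro k
    exact (Measure.quasiMeasurePreserving_eval (fun _ : S => expMeasure 1) k).ae
      ae_expMeasure_one_pos
  refine lintegral_congr_ae ?_
  filter_upwards [hpos] with z hz
  rw [Measure.map_apply hWmeas (measurable_prodMk_left hAmeas),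
    ← measure_generates_given hmeas hlaw hindep hS i hz]
  congr 1
  ext ω
  exact hAW z ω

end

/-! ### Change of variables and regrouping of coefficients. -/

/-- The substitution `u = n * exp (-s)`. -/
theorem lintegral_erlangDensity_mul_eq (m : ℕ) {n : ℕ} (hn : 0 < n) :
    ∫⁻ s, erlangDensity m s * ENNReal.ofReal (Real.exp (-(m * s)) *
        (1 - Real.exp (-s)) ^ (n - (m + 1))) =
      ∫⁻ u in Set.Ioo 0 (n : ℝ), ENNReal.ofReal (((n : ℝ) ^ (m + 1) * m !)⁻¹ *
        ((Real.log n - Real.log u) ^ m * u ^ m * (1 - u / n) ^ (n - (m + 1)))) := by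
  have hn' : (0 : ℝ) < n := by exact_mod_cast hn
  have himage : (fun s : ℝ => n * Real.exp (-s)) '' Set.Ioi 0 = Set.Ioo 0 (n : ℝ) := by
    ext u
    constructor
    · rintro ⟨s, hs, rfl⟩
      refine ⟨by positivity, mul_lt_of_lt_one_right hn' ?_⟩
      rw [Real.exp_lt_one_iff]
      exact neg_lt_zero.2 hs
    · rintro ⟨h0, h1⟩
      refine ⟨Real.log n - Real.log u, sub_pos.2 (Real.log_lt_log h0 h1), ?_⟩
      simp only [neg_sub]
      rw [Real.exp_sub, Real.exp_log h0, Real.exp_log hn']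
      field_simp
  have hderiv : ∀ s ∈ Set.Ioi (0 : ℝ), HasDerivWithinAt (fun s : ℝ => n * Real.exp (-s))
      (n * (Real.exp (-s) * -1)) (Set.Ioi 0) s := fun s _ =>
    (((hasDerivAt_neg s).exp).const_mul _).hasDerivWithinAt
  have hinj : Set.InjOn (fun s : ℝ => n * Real.exp (-s)) (Set.Ioi 0) := by
    intro s _ t _ h
    simpa [hn'.ne'] using h
  rw [← himage, lintegral_image_eq_lintegral_abs_deriv_mul measurableSet_Ioi hderiv hinj,
    ← lintegral_indicator measurableSet_Ioi]
  refine lintegral_congr fun s => ?_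
  by_cases hs : s ∈ Set.Ioi (0 : ℝ)
  · have hs0 : (0 : ℝ) < s := hs
    rw [Set.indicator_of_mem hs, erlangDensity, Set.indicator_of_mem hs,
      ← ENNReal.ofReal_mul (by positivity), ← ENNReal.ofReal_mul (abs_nonneg _)]
    congr 1
    have hlog : Real.log n - Real.log (n * Real.exp (-s)) = s := by
      rw [Real.log_mul hn'.ne' (Real.exp_pos _).ne', Real.log_exp]
      ring
    have habs : |n * (Real.exp (-s) * -1)| = n * Real.exp (-s) := by
      rw [abs_of_nonpos (by nlinarith [mul_pos hn' (Real.exp_pos (-s))])]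
      ring
    have hexp : Real.exp (-(m * s)) = Real.exp (-s) ^ m := by
      rw [← Real.exp_nat_mul]; ring_nf
    rw [hlog, habs, hexp, mul_div_cancel_left₀ _ hn'.ne']
    have := Nat.factorial_pos m
    rw [mul_pow]
    field_simp
    ring
  · rw [Set.indicator_of_notMem hs, erlangDensity, Set.indicator_of_notMem hs, zero_mul]

theorem measureReal_generates {d : ℕ} {Ω : Type*} [MeasurableSpace Ω] {P : Measure Ω}
    [IsProbabilityMeasure P] {X : ℕ → Ω → Fin d → ℝ} (hmeas : ∀ i, Measurable (X i))
    (hlaw : ∀ i, P.map (X i) = Measure.pi (fun _ : Fin d => expMeasure 1))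
    (hindep : iIndepFun X P) {n m : ℕ} (hn : 0 < n) {S : Finset (Fin d)} (hS : S.card = m + 1)
    (i : S ↪ Fin n) :
    P.real {ω | Generates (fun r => X r ω) S i} =
      ((n : ℝ) ^ (m + 1) * m !)⁻¹ * ∫ u in Set.Ioo 0 (n : ℝ),
        (Real.log n - Real.log u) ^ m * u ^ m * (1 - u / n) ^ (n - (m + 1)) := by
  have hn' : (0 : ℝ) < n := by exact_mod_cast hn
  rw [measureReal_def, measure_generates hmeas hlaw hindep hS i,
    lintegral_erlangDensity_mul_eq m hn, ← integral_const_mul,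
    integral_eq_lintegral_of_nonneg_ae]
  · filter_upwards [ae_restrict_mem measurableSet_Ioo] with u hu
    have h1 : 0 ≤ Real.log n - Real.log u := sub_nonneg.2 (Real.log_le_log hu.1 hu.2.le)
    have h2 : 0 ≤ 1 - u / n := sub_nonneg.2 ((div_le_one hn').2 hu.2.le)
    have h3 : 0 ≤ u := hu.1.le
    positivity
  · exact Measurable.aestronglyMeasurable (by fun_prop)

theorem genCoeff_zero {d : ℕ} (hd : 1 ≤ d) : genCoeff d 0 = 1 := by
  obtain ⟨m, rfl⟩ := Nat.exists_eq_add_of_le' hd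
  have hm : (m ! : ℝ) ≠ 0 := by exact_mod_cast m.factorial_ne_zero
  simp [genCoeff, Real.Gamma_nat_eq_factorial, hm]

/-- Put m = d-1-j+k: the exponent m-k equals d-1-j, and the factor C(m,k)/m! equals 1/(k!(d-1-j)!).
-/
theorem pow_mul_sum_genCoeff (d : ℕ) {L : ℝ} (hL : L ≠ 0) :
    L ^ (d - 1) * ∑ j ∈ Finset.range d, genCoeff d j * L ^ (-(j : ℤ)) =
      ∑ m ∈ Finset.range d, (d.choose (m + 1) : ℝ) / m ! *
        ∑ k ∈ Finset.range (m + 1), (m.choose k : ℝ) * L ^ (m - k) *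
          ((-1) ^ k * iteratedDeriv k Real.Gamma ((m + 1 : ℕ) : ℝ)) := by
  simp only [genCoeff, Finset.sum_mul, Finset.mul_sum]
  rw [Finset.sum_sigma', Finset.sum_sigma']
  -- The reindexing is an involution, so one formula serves in both directions.
  refine Finset.sum_bij' (fun p _ => ⟨d - 1 - p.1 + p.2, p.2⟩) (fun p _ => ⟨d - 1 - p.1 + p.2, p.2⟩)
    ?_ ?_ ?_ ?_ ?_
  · rintro ⟨j, k⟩ h
    simp only [Finset.mem_sigma, Finset.mem_range] at h ⊢
    omega
  · rintro ⟨j, k⟩ h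
    simp only [Finset.mem_sigma, Finset.mem_range] at h ⊢
    omega
  · rintro ⟨j, k⟩ h
    simp only [Finset.mem_sigma, Finset.mem_range] at h
    simp only [Sigma.mk.injEq, heq_eq_eq, and_true]
    omega
  · rintro ⟨j, k⟩ h
    simp only [Finset.mem_sigma, Finset.mem_range] at h
    simp only [Sigma.mk.injEq, heq_eq_eq, and_true]
    omega
  · rintro ⟨j, k⟩ h
    simp only [Finset.mem_sigma, Finset.mem_range] at h
    obtain ⟨i, rfl⟩ : ∃ i, d = i + 1 + j := ⟨d - 1 - j, by omega⟩
    have e1 : i + j - j = i := by omega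
    have e2 : i + 1 + j - j + k = i + k + 1 := by omega
    have e3 : i + 1 + j - 1 = i + j := by omega
    have e4 : i + k - k = i := by omega
    simp only [e2, e3, e1, e4]
    have hk : (k ! : ℝ) ≠ 0 := by exact_mod_cast k.factorial_ne_zero
    have hi : (i ! : ℝ) ≠ 0 := by exact_mod_cast i.factorial_ne_zero
    rw [Nat.cast_choose ℝ (Nat.le_add_left k i), e4, zpow_neg, zpow_natCast, pow_add]
    have hik : ((i + k)! : ℝ) ≠ 0 := by exact_mod_cast (i + k).factorial_ne_zero
    field_simp

/-! ### The exact expectation and the theorem. -/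

section

variable {d : ℕ} {Ω : Type*} [MeasurableSpace Ω] {P : Measure Ω} [IsProbabilityMeasure P]
  {X : ℕ → Ω → Fin d → ℝ}

open Classical in
theorem ae_numGenerators_eq_sum (hmeas : ∀ i, Measurable (X i))
    (hlaw : ∀ i, P.map (X i) = Measure.pi (fun _ : Fin d => expMeasure 1))
    (hindep : iIndepFun X P) {n : ℕ} (hn : 0 < n) :
    (fun ω => (numGenerators (fun i => X i ω) n : ℝ)) =ᵐ[P] fun ω =>
      ∑ S : Finset (Fin d), ∑ i : S ↪ Fin n,
        {ω | Generates (fun r => X r ω) S i}.indicator (fun _ => (1 : ℝ)) ω := by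
  filter_upwards [ae_pos_coord hmeas hlaw, ae_coord_ne hmeas hlaw hindep] with ω h1 h2
  rw [numGenerators_eq_sum hn (fun i _ j => h1 i j) fun i _ i' _ j => h2 i i' j]
  simp [Set.indicator_apply]

theorem integrable_numGenerators (hmeas : ∀ i, Measurable (X i))
    (hlaw : ∀ i, P.map (X i) = Measure.pi (fun _ : Fin d => expMeasure 1))
    (hindep : iIndepFun X P) (n : ℕ) :
    Integrable (fun ω => (numGenerators (fun i => X i ω) n : ℝ)) P := by
  rcases n.eq_zero_or_pos with rfl | hn
  · simp [numGenerators, generators_zero]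
  refine Integrable.congr ?_ (ae_numGenerators_eq_sum hmeas hlaw hindep hn).symm
  exact integrable_finsetSum _ fun S _ => integrable_finsetSum _ fun i _ =>
    (integrable_const 1).indicator (measurableSet_generates hmeas S i)

theorem integral_numGenerators (hmeas : ∀ i, Measurable (X i))
    (hlaw : ∀ i, P.map (X i) = Measure.pi (fun _ : Fin d => expMeasure 1))
    (hindep : iIndepFun X P) {n : ℕ} (hn : 0 < n) :
    ∫ ω, (numGenerators (fun i => X i ω) n : ℝ) ∂P =
      ∑ m ∈ Finset.range d, (d.choose (m + 1) : ℝ) / m ! *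
        (n.descFactorial (m + 1) / (n : ℝ) ^ (m + 1) *
          ∫ u in Set.Ioo 0 (n : ℝ), (Real.log n - Real.log u) ^ m * u ^ m *
            (1 - u / n) ^ (n - (m + 1))) := by
  rw [integral_congr_ae (ae_numGenerators_eq_sum hmeas hlaw hindep hn),
    integral_finsetSum _ fun S _ => integrable_finsetSum _ fun i _ =>
      (integrable_const 1).indicator (measurableSet_generates hmeas S i)]
  -- The contribution of S depends only on its size k = m+1. It vanishes for k = 0, since the empty
  -- set generates nothing once n > 0.
  set f : ℕ → ℝ := fun k => if k = 0 then 0 else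
    n.descFactorial k * (((n : ℝ) ^ k * (k - 1)!)⁻¹ * ∫ u in Set.Ioo 0 (n : ℝ),
      (Real.log n - Real.log u) ^ (k - 1) * u ^ (k - 1) * (1 - u / n) ^ (n - k)) with hf
  have hterm : ∀ S : Finset (Fin d), ∫ ω, ∑ i : S ↪ Fin n,
      {ω | Generates (fun r => X r ω) S i}.indicator (fun _ => (1 : ℝ)) ω ∂P = f S.card := by
    intro S
    rw [integral_finsetSum _ fun i _ =>
      (integrable_const 1).indicator (measurableSet_generates hmeas S i)]
    have h1 : ∀ i : S ↪ Fin n,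
        ∫ ω, {ω | Generates (fun r => X r ω) S i}.indicator (fun _ => (1 : ℝ)) ω ∂P =
          P.real {ω | Generates (fun r => X r ω) S i} := fun i =>
      integral_indicator_one (measurableSet_generates hmeas S i)
    simp_rw [h1]
    rcases Nat.eq_zero_or_eq_succ_pred S.card with h | h
    · rw [h]
      simp only [hf, if_true]
      refine Finset.sum_eq_zero fun i _ => ?_
      have : {ω | Generates (fun r => X r ω) S i} = ∅ := by
        ext ω
        simp only [Set.mem_ofPred_eq, Set.mem_empty_iff_false, iff_false]
        intro hg
        exact (hg.nonempty hn).ne_empty (Finset.card_eq_zero.1 h)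
      rw [this, measureReal_empty]
    · set m := S.card.pred
      -- All injections are equally likely to generate, and their number is the falling factorial.
      rw [Finset.sum_congr rfl fun i _ => measureReal_generates hmeas hlaw hindep hn h i,
        Finset.sum_const, Finset.card_univ, Fintype.card_embedding_eq, Fintype.card_fin,
        Fintype.card_coe, h, nsmul_eq_mul]
      simp [hf]
  rw [Finset.sum_congr rfl fun S _ => hterm S, ← Finset.powerset_univ,
    Finset.sum_powerset_apply_card f, Finset.card_univ, Fintype.card_fin, Finset.sum_range_succ']
  simp only [hf, if_true, smul_zero, add_zero, Nat.add_eq_zero_iff, one_ne_zero, and_false,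
    if_false, Nat.add_sub_cancel, nsmul_eq_mul]
  refine Finset.sum_congr rfl fun m _ => ?_
  rw [mul_inv]
  ring

end

theorem theorem6p6 (d : ℕ) (hd : 1 ≤ d)
    {Ω : Type*} [MeasurableSpace Ω] (P : Measure Ω) [IsProbabilityMeasure P]
    (X : ℕ → Ω → Fin d → ℝ)
    (hmeas : ∀ i, Measurable (X i))
    (hlaw : ∀ i, P.map (X i) = Measure.pi (fun _ : Fin d => expMeasure 1))
    (hindep : iIndepFun X P) :
    (∀ n, (∀ᵐ ω ∂P, (generators (fun i => X i ω) n).Finite) ∧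
      Integrable (fun ω => (numGenerators (fun i => X i ω) n : ℝ)) P) ∧
    (fun n : ℕ =>
        (∫ ω, (numGenerators (fun i => X i ω) n : ℝ) ∂P) -
          Real.log n ^ (d - 1) *
            ∑ j ∈ Finset.range d, genCoeff d j * Real.log n ^ (-(j : ℤ)))
      =O[atTop] (fun n : ℕ => (n : ℝ)⁻¹ * Real.log n ^ (d - 1)) ∧
    genCoeff d 0 = 1 := by
  refine ⟨fun n => ⟨?_, integrable_numGenerators hmeas hlaw hindep n⟩, ?_, genCoeff_zero hd⟩
  · rcases n.eq_zero_or_pos with rfl | hn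
    · simp [generators_zero]
    · filter_upwards [ae_pos_coord hmeas hlaw] with ω h
      exact finite_generators hn fun i _ j => h i j
  have hlog : ∀ᶠ n : ℕ in atTop, 1 ≤ Real.log n :=
    (Real.tendsto_log_atTop.comp tendsto_natCast_atTop_atTop).eventually_ge_atTop 1
  -- Once ln n ≥ 1, the errors for smaller m are absorbed into the one for m = d-1.
  have hpow : ∀ m ∈ Finset.range d, (fun n : ℕ => (n : ℝ)⁻¹ * Real.log n ^ m)
      =O[atTop] fun n : ℕ => (n : ℝ)⁻¹ * Real.log n ^ (d - 1) := by
    intro m hm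
    refine IsBigO.of_bound 1 ?_
    filter_upwards [hlog] with n hn
    have hn0 : 0 ≤ Real.log n := by linarith
    rw [one_mul, Real.norm_of_nonneg (by positivity), Real.norm_of_nonneg (by positivity)]
    have := Finset.mem_range.1 hm
    gcongr
    omega
  have hsum := IsBigO.sum (s := Finset.range d) fun m hm =>
    ((isBigO_descFactorial_mul_integral_sub m).trans (hpow m hm)).const_mul_left
      ((d.choose (m + 1) : ℝ) / m !)
  refine hsum.congr' ?_ EventuallyEq.rfl
  filter_upwards [hlog, eventually_gt_atTop 0] with n hn hn0
  rw [integral_numGenerators hmeas hlaw hindep hn0, pow_mul_sum_genCoeff d (by linarith),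
    ← Finset.sum_sub_distrib]
  rw [Finset.sum_apply]
  exact Finset.sum_congr rfl fun m _ => mul_sub _ _ _
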